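/- \textbf{Theorem 1.} Consider a relay channel with one source, one relay and one destination, whose channel coefficients $h_{sr},h_{rd},h_{sd}$ are independent $\mathcal{CN}(0,\sigma^2)$ random variables ($\sigma^2>0$), constant during each block; all noises have unit variance and every transmitter has signal-to-noise ratio $\rho$. In each block one of two modes is selected, depending on the channel coefficients. In the direct mode (relay off) the mutual information is $I_1=\log(1+\rho|h_{sd}|^2)$. In the relayed mode (relay on), the mutual information for orthogonal amplify-and-forward (AF) is $$I_2=\tfrac12\log\Bigl(1+\rho|h_{sd}|^2+\tfrac{\rho|h_{sr}|^2\,\rho|h_{rd}|^2}{\rho|h_{sr}|^2+\rho|h_{rd}|^2+1}\Bigr),$$ and for orthogonal decode-and-forward (DF) at rate $R$ it is $I_2=\tfrac12\log\bigl(1+\rho(|h_{sd}|^2+|h_{rd}|^2)\bigr)$ if the relay can decode, that is, if $\tfrac12\log(1+\rho|h_{sr}|^2)\ge R$, and $I_2=\tfrac12\log(1+2\rho|h_{sd}|^2)$ otherwise. A mode is in outage at rate $R$ if its mutual information is less than $R$, and the system is in outage if the selected mode is. Let the rate $R(\rho)$ have multiplexing gain $r$, that is, $R(\rho)/\log\rho\to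 r$ as $\rho\to\infty$, and let $R(\rho)$ be bounded below by a positive constant for all large $\rho$ (this is automatic if $r>0$). The diversity gain of a probability $P(\rho)$ is $-\lim_{\rho\to\infty}\log P(\rho)/\log\rho$. Write $x^+=\max(x,0)$. Then, both for AF and for DF: (i) Suppose that the selection rule is opportunistic, in the sense that for all large $\rho$ it selects a mode in outage only when both modes are in outage. (Examples are selecting the mode with the larger mutual information, and switching the relay on exactly when the direct mode is in outage.) Then the outage probability of the system has diversity gain $$d(r)=(1-r)^++(1-2r)^+ .$$ (ii) No selection rule does better: for every rule, with outage probability $P(\rho)$, $\limsup_{\rho\to\infty}\bigl(-\log P(\rho)/\log\rho\bigr)\le d(r)$. (iii) The outage probability of the direct mode has diversity gain $(1-r)^+$, and the conditional outage probability of the relayed mode, given that the direct mode is in outage, has diversity gain $(1-2r)^+$. -/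

import Mathlib

open MeasureTheory ProbabilityTheory Filter Topology
open scoped NNReal

namespace RelayChannel

/-- The law `CN(0, v)` of a circularly symmetric complex Gaussian of variance `v`: real and
imaginary parts are independent, real Gaussian, centred, of variance `v / 2`. -/
noncomputable def complexGaussian (v : ℝ≥0) : Measure ℂ :=
  ((gaussianReal 0 (v / 2)).prod (gaussianReal 0 (v / 2))).map
    (fun z : ℝ × ℝ => (z.1 : ℂ) + (z.2 : ℂ) * Complex.I)

/-- The three links: source-relay, relay-destination, source-destination. -/
inductive Link
  | sr
  | rd
  | sd

/-- The orthogonal relaying protocol used when the relay is on. -/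
inductive Protocol
  /-- amplify and forward -/
  | AF
  /-- decode and forward -/
  | DF

/-- The two access modes: relay off, where the source transmits in both half-intervals, and relay
on, where the second half-interval is handed to the relaying protocol. -/
inductive Mode
  | direct
  | relayed

/-- A realization of the three channel coefficients, fixed during a block. -/
abbrev Gains : Type := Link → ℂ

/-- Received signal-to-noise ratio `ρ |h_l|²` of the link `l`; noises have unit variance. -/
noncomputable def snr (ρ : ℝ) (g : Gains) (l : Link) : ℝ := ρ * ‖g l‖ ^ 2

/-- Mutual information `log (1 + ρ |h_sd|²)` of the direct mode (all rates are in nats). -/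
noncomputable def directMI (ρ : ℝ) (g : Gains) : ℝ :=
  Real.log (1 + snr ρ g Link.sd)

/-- Mutual information of orthogonal amplify-and-forward relaying,
`1/2 log (1 + ρ |h_sd|² + f (ρ |h_sr|², ρ |h_rd|²))` with `f (x, y) = x y / (x + y + 1)`. -/
noncomputable def afMI (ρ : ℝ) (g : Gains) : ℝ :=
  1 / 2 * Real.log (1 + snr ρ g Link.sd +
    snr ρ g Link.sr * snr ρ g Link.rd / (snr ρ g Link.sr + snr ρ g Link.rd + 1))

/-- The relay hears the message of rate `R` during one half-interval, so it can decode if and only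
if `R ≤ 1/2 log (1 + ρ |h_sr|²)`, which for `ρ > 0` says `|h_sr|² ≥ (e ^ (2 R) - 1) / ρ`. -/
def RelayDecodes (ρ R : ℝ) (g : Gains) : Prop :=
  R ≤ 1 / 2 * Real.log (1 + snr ρ g Link.sr)

open Classical in
/-- Mutual information of orthogonal decode-and-forward relaying at rate `R`: a relay that decodes
forwards the message in the second half-interval, otherwise the source continues. -/
noncomputable def dfMI (ρ R : ℝ) (g : Gains) : ℝ :=
  if RelayDecodes ρ R g then
    1 / 2 * Real.log (1 + (snr ρ g Link.sd + snr ρ g Link.rd))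
  else
    1 / 2 * Real.log (1 + 2 * snr ρ g Link.sd)

/-- Instantaneous end-to-end mutual information of each mode. -/
noncomputable def modeMI : Protocol → ℝ → ℝ → Gains → Mode → ℝ
  | _, ρ, _, g, Mode.direct => directMI ρ g
  | Protocol.AF, ρ, _, g, Mode.relayed => afMI ρ g
  | Protocol.DF, ρ, R, g, Mode.relayed => dfMI ρ R g

/-- The mode `m` cannot support the rate `R`. -/
def InOutage (p : Protocol) (ρ R : ℝ) (g : Gains) (m : Mode) : Prop :=
  modeMI p ρ R g m < R

/-- An on/off rule chooses a mode from the channel coefficients, for each transmit SNR. -/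
abbrev SelectionRule : Type := ℝ → Gains → Mode

/-- At high SNR, the rule selects a mode in outage only when both modes are in outage. -/
def IsOpportunistic (p : Protocol) (R : ℝ → ℝ) (s : SelectionRule) : Prop :=
  ∀ᶠ ρ in atTop, ∀ g : Gains,
    InOutage p ρ (R ρ) g (s ρ g) → ∀ m : Mode, InOutage p ρ (R ρ) g m

open Classical in
/-- Keep the relay off whenever the direct link supports the rate; otherwise switch it on. -/
noncomputable def directFirstRule (p : Protocol) (R : ℝ → ℝ) : SelectionRule := fun ρ g =>
  if InOutage p ρ (R ρ) g Mode.direct then Mode.relayed else Mode.direct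

open Classical in
/-- Choose the mode with the larger instantaneous end-to-end mutual information. -/
noncomputable def maxMIRule (p : Protocol) (R : ℝ → ℝ) : SelectionRule := fun ρ g =>
  if modeMI p ρ (R ρ) g Mode.direct < modeMI p ρ (R ρ) g Mode.relayed then Mode.relayed
  else Mode.direct

section Outage

variable {Ω : Type*} [MeasurableSpace Ω]

/-- The event that the mode `m` is in outage, at SNR `ρ` and rate `R`. -/
def outageEvent (h : Link → Ω → ℂ) (p : Protocol) (ρ R : ℝ) (m : Mode) : Set Ω :=
  {ω | InOutage p ρ R (fun l => h l ω) m}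

/-- Outage probability of the single mode `m`. -/
noncomputable def modeOutageProb (μ : Measure Ω) (h : Link → Ω → ℂ) (p : Protocol)
    (R : ℝ → ℝ) (m : Mode) (ρ : ℝ) : ℝ :=
  μ.real (outageEvent h p ρ (R ρ) m)

/-- Outage probability of the relayed mode given that the direct mode is in outage. -/
noncomputable def relayedOutageProbGivenDirect (μ : Measure Ω) (h : Link → Ω → ℂ) (p : Protocol)
    (R : ℝ → ℝ) (ρ : ℝ) : ℝ :=
  (cond μ (outageEvent h p ρ (R ρ) Mode.direct)).real (outageEvent h p ρ (R ρ) Mode.relayed)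

/-- Outage probability of the system that switches modes by the rule `s`: the probability that the
selected mode cannot support the rate. -/
noncomputable def systemOutageProb (μ : Measure Ω) (h : Link → Ω → ℂ) (p : Protocol)
    (R : ℝ → ℝ) (s : SelectionRule) (ρ : ℝ) : ℝ :=
  μ.real {ω | InOutage p ρ (R ρ) (fun l => h l ω) (s ρ (fun l => h l ω))}

end Outage

/-- `P(ρ)` has diversity gain `d`: it is positive at high SNR and
`- log P(ρ) / log ρ → d` as `ρ → ∞`. -/
def HasDiversity (P : ℝ → ℝ) (d : ℝ) : Prop :=
  (∀ᶠ ρ in atTop, 0 < P ρ) ∧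
    Tendsto (fun ρ => -(Real.log (P ρ) / Real.log ρ)) atTop (𝓝 d)

/-- The diversity gain of `P(ρ)` is at most `d`: `P` is positive at high SNR and the upper limit of
`- log P(ρ) / log ρ` as `ρ → ∞` is at most `d`. -/
def DiversityAtMost (P : ℝ → ℝ) (d : ℝ) : Prop :=
  (∀ᶠ ρ in atTop, 0 < P ρ) ∧
    ∀ ε > 0, ∀ᶠ ρ in atTop, -(Real.log (P ρ) / Real.log ρ) ≤ d + ε

/-- The rates `R(ρ)` have multiplexing gain `r`: `R(ρ) / log ρ → r` as `ρ → ∞`. Moreover `R` is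
bounded away from zero at high SNR, which is automatic for `r > 0`; for `r = 0` it excludes
rates that vanish. -/
def HasMultiplexingGain (R : ℝ → ℝ) (r : ℝ) : Prop :=
  Tendsto (fun ρ => R ρ / Real.log ρ) atTop (𝓝 r) ∧ ∃ c > 0, ∀ᶠ ρ in atTop, c ≤ R ρ

end RelayChannel

/-!
The diversity gain turns products into sums and is insensitive to constant factors
(`HasDiversity.mul`, `HasDiversity.squeeze`), so the outage events need only be known up to
constants. Two facts suffice.

* The squared modulus of a `CN(0, v)` variable is below `t` with probability comparable to
  `min t 1` (`exists_gainProb_bounds`), because its density is bounded, and bounded below near the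
  origin. Hence if `t(ρ)` has diversity gain `a`, then this probability has diversity gain
  `max a 0` (`HasDiversity.gainProb`).
* With `X`, `Y`, `Z` the squared moduli of the coefficients `sd`, `sr`, `rd`, the direct mode is in
  outage exactly when `X < (e ^ R - 1) / ρ`. If moreover `Y < e ^ R (e ^ R - 1) / ρ`, then the relayed
  mode is in outage as well, for either protocol (`inOutage_of_norm_sq_lt`); conversely, an outage of
  the relayed mode forces `Y` or `Z` below `2 e ^ (2 R) / ρ` (`norm_sq_lt_of_inOutage_relayed`).

The two thresholds for `Y` and `Z` have the same diversity gain `1 - 2 r`. By independence, and a union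
bound in the upper estimate, the event that both modes are in outage has diversity gain
`max (1 - r) 0 + max (1 - 2 r) 0` (`hasDiversity_bothOutage`). Every selection rule suffers at
least this event, an opportunistic rule suffers nothing more, and the conditional probability is a
quotient of two probabilities whose diversity gains are then known.
-/

namespace RelayChannel

/-! ### Calculus of diversity gains -/

theorem HasDiversity.mul {P Q : ℝ → ℝ} {a b : ℝ} (hP : HasDiversity P a)
    (hQ : HasDiversity Q b) : HasDiversity (fun ρ => P ρ * Q ρ) (a + b) := by
  refine ⟨?_, (hP.2.add hQ.2).congr' ?_⟩
  · filter_upwards [hP.1, hQ.1] with ρ h1 h2 using mul_pos h1 h2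
  · filter_upwards [hP.1, hQ.1] with ρ h1 h2
    rw [Real.log_mul h1.ne' h2.ne']
    ring

theorem HasDiversity.inv {P : ℝ → ℝ} {a : ℝ} (hP : HasDiversity P a) :
    HasDiversity (fun ρ => (P ρ)⁻¹) (-a) := by
  refine ⟨?_, hP.2.neg.congr fun ρ => ?_⟩
  · filter_upwards [hP.1] with ρ h1 using inv_pos.2 h1
  · rw [Real.log_inv]
    ring

theorem hasDiversity_const {c : ℝ} (hc : 0 < c) : HasDiversity (fun _ => c) 0 := by
  refine ⟨Eventually.of_forall fun _ => hc, ?_⟩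
  simpa using (Real.tendsto_log_atTop.const_div_atTop (Real.log c)).neg

theorem hasDiversity_inv_id : HasDiversity (fun ρ => ρ⁻¹) 1 := by
  refine ⟨?_, tendsto_const_nhds.congr' ?_⟩
  · filter_upwards [eventually_gt_atTop 0] with ρ h using inv_pos.2 h
  · filter_upwards [eventually_gt_atTop 1] with ρ h
    rw [Real.log_inv, neg_div, neg_neg, div_self (Real.log_pos h).ne']

theorem HasDiversity.squeeze {P Q S : ℝ → ℝ} {a : ℝ} (hP : HasDiversity P a)
    (hS : HasDiversity S a) (h1 : ∀ᶠ ρ in atTop, P ρ ≤ Q ρ) (h2 : ∀ᶠ ρ in atTop, Q ρ ≤ S ρ) :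
    HasDiversity Q a := by
  have hQ : ∀ᶠ ρ in atTop, 0 < Q ρ := by
    filter_upwards [hP.1, h1] with ρ h0 h1 using h0.trans_le h1
  refine ⟨hQ, tendsto_of_tendsto_of_tendsto_of_le_of_le' hS.2 hP.2 ?_ ?_⟩
  · filter_upwards [hQ, h2, eventually_gt_atTop 1] with ρ h0 h2 hρ
    have := Real.log_pos hρ
    gcongr
  · filter_upwards [hP.1, h1, eventually_gt_atTop 1] with ρ h0 h1 hρ
    have := Real.log_pos hρ
    gcongr

theorem HasDiversity.congr {P Q : ℝ → ℝ} {a : ℝ} (hP : HasDiversity P a)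
    (h : ∀ᶠ ρ in atTop, P ρ = Q ρ) : HasDiversity Q a :=
  hP.squeeze hP (h.mono fun _ h => h.le) (h.mono fun _ h => h.ge)

theorem HasDiversity.const_mul {P : ℝ → ℝ} {a c : ℝ} (hP : HasDiversity P a) (hc : 0 < c) :
    HasDiversity (fun ρ => c * P ρ) a := by
  simpa using (hasDiversity_const hc).mul hP

theorem HasDiversity.min_one {P : ℝ → ℝ} {a : ℝ} (hP : HasDiversity P a) :
    HasDiversity (fun ρ => min (P ρ) 1) (max a 0) := by
  refine ⟨?_, (hP.2.max tendsto_const_nhds).congr' ?_⟩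
  · filter_upwards [hP.1] with ρ h using lt_min h one_pos
  · filter_upwards [hP.1, eventually_gt_atTop 1] with ρ h hρ
    have hl := Real.log_pos hρ
    rcases le_total (P ρ) 1 with h1 | h1
    · rw [min_eq_left h1, max_eq_left]
      exact neg_nonneg.2 (div_nonpos_of_nonpos_of_nonneg (Real.log_nonpos h.le h1) hl.le)
    · rw [min_eq_right h1, max_eq_right]
      · simp
      · exact neg_nonpos.2 (div_nonneg (Real.log_nonneg h1) hl.le)

/-- A probability that dominates one of diversity gain `a` has diversity gain at most `a`. -/
theorem HasDiversity.diversityAtMost_of_le {P Q : ℝ → ℝ} {a : ℝ} (hP : HasDiversity P a)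
    (h : ∀ᶠ ρ in atTop, P ρ ≤ Q ρ) : DiversityAtMost Q a := by
  refine ⟨?_, fun ε hε => ?_⟩
  · filter_upwards [hP.1, h] with ρ h0 h1 using h0.trans_le h1
  · filter_upwards [hP.1, h, eventually_gt_atTop 1,
      hP.2.eventually (eventually_le_nhds (lt_add_of_pos_right a hε))] with ρ h0 h1 hρ h2
    refine le_trans ?_ h2
    have := Real.log_pos hρ
    gcongr

/-! ### Thresholds at multiplexing gain `r` -/

theorem HasMultiplexingGain.exp {R : ℝ → ℝ} {r : ℝ} (hR : HasMultiplexingGain R r) :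
    HasDiversity (fun ρ => Real.exp (R ρ)) (-r) :=
  ⟨Eventually.of_forall fun _ => Real.exp_pos _, by simpa using hR.1.neg⟩

/-- This is where the positive lower bound on the rate enters: for a vanishing rate `e ^ R - 1`
may be of smaller order than `e ^ R`. -/
theorem HasMultiplexingGain.exp_sub_one {R : ℝ → ℝ} {r : ℝ} (hR : HasMultiplexingGain R r) :
    HasDiversity (fun ρ => Real.exp (R ρ) - 1) (-r) := by
  obtain ⟨c, hc, hcR⟩ := hR.2
  have hpos : 0 < 1 - Real.exp (-c) := by
    simpa using hc
  refine (hR.exp.const_mul hpos).squeeze hR.exp ?_ (Eventually.of_forall fun ρ => by simp)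
  filter_upwards [hcR] with ρ h
  have : 1 ≤ Real.exp (-c) * Real.exp (R ρ) := by
    rw [← Real.exp_add]
    exact Real.one_le_exp (by linarith)
  linarith

theorem HasMultiplexingGain.directThreshold {R : ℝ → ℝ} {r : ℝ} (hR : HasMultiplexingGain R r) :
    HasDiversity (fun ρ => (Real.exp (R ρ) - 1) / ρ) (1 - r) := by
  have := hR.exp_sub_one.mul hasDiversity_inv_id
  rwa [show -r + 1 = 1 - r by ring] at this

theorem HasMultiplexingGain.lowerThreshold {R : ℝ → ℝ} {r : ℝ} (hR : HasMultiplexingGain R r) :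
    HasDiversity (fun ρ => Real.exp (R ρ) * (Real.exp (R ρ) - 1) / ρ) (1 - 2 * r) := by
  have := (hR.exp.mul hR.exp_sub_one).mul hasDiversity_inv_id
  rwa [show -r + -r + 1 = 1 - 2 * r by ring] at this

theorem HasMultiplexingGain.upperThreshold {R : ℝ → ℝ} {r : ℝ} (hR : HasMultiplexingGain R r) :
    HasDiversity (fun ρ => 2 * Real.exp (R ρ) ^ 2 / ρ) (1 - 2 * r) := by
  have := ((hR.exp.mul hR.exp).mul hasDiversity_inv_id).const_mul two_pos
  rw [show -r + -r + 1 = 1 - 2 * r by ring] at this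
  exact this.congr (Eventually.of_forall fun ρ => by ring)

/-! ### Small-ball probabilities of the complex Gaussian -/

theorem gaussianReal_Ioo_le {w : ℝ≥0} (hw : w ≠ 0) {s : ℝ} (hs : 0 ≤ s) :
    (gaussianReal 0 w).real (Set.Ioo (-s) s) ≤ (√(2 * Real.pi * w))⁻¹ * (2 * s) := by
  refine ENNReal.toReal_le_of_le_ofReal (by positivity) ?_
  rw [gaussianReal_apply 0 hw]
  calc ∫⁻ x in Set.Ioo (-s) s, gaussianPDF 0 w x
      ≤ ∫⁻ _ in Set.Ioo (-s) s, ENNReal.ofReal (√(2 * Real.pi * w))⁻¹ := by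
        refine lintegral_mono fun x => ENNReal.ofReal_le_ofReal ?_
        rw [gaussianPDFReal]
        refine mul_le_of_le_one_right (by positivity) (Real.exp_le_one_iff.2 ?_)
        exact div_nonpos_of_nonpos_of_nonneg (neg_nonpos.2 (sq_nonneg _)) (by positivity)
    _ = ENNReal.ofReal ((√(2 * Real.pi * w))⁻¹ * (2 * s)) := by
        rw [setLIntegral_const, Real.volume_Ioo, ← ENNReal.ofReal_mul (by positivity)]
        congr 2
        ring

theorem le_gaussianReal_Ioo {w : ℝ≥0} (hw : w ≠ 0) {s : ℝ} (hs1 : s ≤ 1) :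
    (√(2 * Real.pi * w))⁻¹ * Real.exp (-1 / (2 * w)) * (2 * s)
      ≤ (gaussianReal 0 w).real (Set.Ioo (-s) s) := by
  refine (ENNReal.ofReal_le_iff_le_toReal (measure_ne_top _ _)).1 ?_
  rw [gaussianReal_apply 0 hw]
  calc ENNReal.ofReal ((√(2 * Real.pi * w))⁻¹ * Real.exp (-1 / (2 * w)) * (2 * s))
      = ∫⁻ _ in Set.Ioo (-s) s,
          ENNReal.ofReal ((√(2 * Real.pi * w))⁻¹ * Real.exp (-1 / (2 * w))) := by
        rw [setLIntegral_const, Real.volume_Ioo, ← ENNReal.ofReal_mul (by positivity)]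
        congr 2
        ring
    _ ≤ ∫⁻ x in Set.Ioo (-s) s, gaussianPDF 0 w x := by
        refine setLIntegral_mono (measurable_gaussianPDF 0 w) fun x hx =>
          ENNReal.ofReal_le_ofReal ?_
        rw [gaussianPDFReal]
        have : (x - 0) ^ 2 ≤ 1 := by
          rw [sub_zero, sq_le_one_iff_abs_le_one, abs_le]
          constructor <;> linarith [hx.1, hx.2]
        gcongr

/-- The probability that the squared modulus of a `CN(0, v)` variable is less than `t`. -/
noncomputable def gainProb (v : ℝ≥0) (t : ℝ) : ℝ :=
  (complexGaussian v).real {z | ‖z‖ ^ 2 < t}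

theorem measurableSet_norm_sq_lt (t : ℝ) : MeasurableSet {z : ℂ | ‖z‖ ^ 2 < t} :=
  measurableSet_lt (by fun_prop) measurable_const

theorem gainProb_eq (v : ℝ≥0) (t : ℝ) :
    gainProb v t = ((gaussianReal 0 (v / 2)).prod (gaussianReal 0 (v / 2))).real
      {z : ℝ × ℝ | z.1 ^ 2 + z.2 ^ 2 < t} := by
  rw [gainProb, complexGaussian,
    map_measureReal_apply (by fun_prop) (measurableSet_norm_sq_lt t)]
  congr 1
  ext z
  simp only [Set.mem_preimage, Set.mem_ofPred_eq, Complex.sq_norm, Complex.normSq_add_mul_I]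

/-- The disc of radius `√t` lies between two squares, on which the two real Gaussian coordinates
are independent with densities bounded above, and bounded below near the origin. -/
theorem exists_gainProb_bounds {v : ℝ≥0} (hv : 0 < v) :
    ∃ c > 0, ∃ C > 0, ∀ t > 0, c * min t 1 ≤ gainProb v t ∧ gainProb v t ≤ C * min t 1 := by
  have hw : v / 2 ≠ 0 := by positivity
  set K : ℝ := (√(2 * Real.pi * (v / 2 : ℝ≥0)))⁻¹ with hK
  set E : ℝ := Real.exp (-1 / (2 * (v / 2 : ℝ≥0))) with hE
  have hK0 : 0 < K := by positivity
  have hE0 : 0 < E := Real.exp_pos _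
  refine ⟨2 * (K * E) ^ 2, by positivity, max (4 * K ^ 2) 1, by positivity, fun t ht => ?_⟩
  rw [gainProb_eq]
  constructor
  · have hm : 0 < min t 1 := lt_min ht one_pos
    set s := √(min t 1 / 2) with hs
    have hs2 : s ^ 2 = min t 1 / 2 := Real.sq_sqrt (by positivity)
    have hs0 : 0 ≤ s := Real.sqrt_nonneg _
    have hs1 : s ≤ 1 := by
      rw [hs, Real.sqrt_le_one]
      linarith [min_le_right t 1]
    have hb := le_gaussianReal_Ioo hw hs1
    calc 2 * (K * E) ^ 2 * min t 1 = (K * E * (2 * s)) * (K * E * (2 * s)) := by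
          linear_combination (-4 * (K * E) ^ 2) * hs2
      _ ≤ _ := mul_le_mul hb hb (by positivity) measureReal_nonneg
      _ = _ := (measureReal_prod_prod _ _).symm
      _ ≤ _ := by
          refine measureReal_mono fun z hz => ?_
          have h1 := sq_lt_sq' hz.1.1 hz.1.2
          have h2 := sq_lt_sq' hz.2.1 hz.2.2
          have := min_le_left t 1
          simp only [Set.mem_ofPred_eq]
          linarith
  · rw [mul_min_of_nonneg _ _ (by positivity), mul_one]
    refine le_min ?_ (measureReal_le_one.trans (le_max_right _ _))
    have hb := gaussianReal_Ioo_le hw (Real.sqrt_nonneg t)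
    calc _ ≤ ((gaussianReal 0 (v / 2)).prod (gaussianReal 0 (v / 2))).real
            (Set.Ioo (-√t) √t ×ˢ Set.Ioo (-√t) √t) := by
          refine measureReal_mono fun z hz => ?_
          simp only [Set.mem_ofPred_eq] at hz
          exact ⟨Real.sq_lt.1 (by nlinarith [sq_nonneg z.2]),
            Real.sq_lt.1 (by nlinarith [sq_nonneg z.1])⟩
      _ = _ := measureReal_prod_prod _ _
      _ ≤ (K * (2 * √t)) * (K * (2 * √t)) :=
          mul_le_mul hb hb measureReal_nonneg (by positivity)
      _ = 4 * K ^ 2 * t := by linear_combination (4 * K ^ 2) * Real.sq_sqrt ht.le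
      _ ≤ _ := by
          gcongr
          exact le_max_left _ _

theorem HasDiversity.gainProb {v : ℝ≥0} (hv : 0 < v) {t : ℝ → ℝ} {a : ℝ}
    (ht : HasDiversity t a) : HasDiversity (fun ρ => gainProb v (t ρ)) (max a 0) := by
  obtain ⟨c, hc, C, hC, h⟩ := exists_gainProb_bounds hv
  exact (ht.min_one.const_mul hc).squeeze (ht.min_one.const_mul hC)
    (ht.1.mono fun ρ hρ => (h _ hρ).1) (ht.1.mono fun ρ hρ => (h _ hρ).2)

/-! ### Outage events in terms of the channel gains -/

theorem snr_nonneg {ρ : ℝ} (hρ : 0 < ρ) (g : Gains) (l : Link) : 0 ≤ snr ρ g l := by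
  unfold snr
  positivity

theorem snr_lt_iff {ρ : ℝ} (hρ : 0 < ρ) (g : Gains) (l : Link) (a : ℝ) :
    snr ρ g l < a ↔ ‖g l‖ ^ 2 < a / ρ := by
  rw [snr, lt_div_iff₀' hρ]

theorem half_log_lt_iff {x R : ℝ} (hx : 0 < x) :
    1 / 2 * Real.log x < R ↔ x < Real.exp R ^ 2 := by
  rw [← Real.exp_nat_mul, ← Real.log_lt_iff_lt_exp hx]
  push_cast
  constructor <;> intro h <;> linarith

theorem inOutage_direct_iff (p : Protocol) {ρ : ℝ} (hρ : 0 < ρ) (R : ℝ) (g : Gains) :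
    InOutage p ρ R g Mode.direct ↔ ‖g Link.sd‖ ^ 2 < (Real.exp R - 1) / ρ := by
  have h0 := snr_nonneg hρ g Link.sd
  rw [← snr_lt_iff hρ, lt_sub_iff_add_lt', ← Real.log_lt_iff_lt_exp (by linarith)]
  cases p <;> rfl

theorem relayDecodes_iff {ρ : ℝ} (hρ : 0 < ρ) (R : ℝ) (g : Gains) :
    RelayDecodes ρ R g ↔ Real.exp R ^ 2 ≤ 1 + snr ρ g Link.sr := by
  have h0 := snr_nonneg hρ g Link.sr
  rw [← not_lt, ← half_log_lt_iff (by linarith), not_lt, RelayDecodes]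

/-- A weak source-relay link puts the relayed mode in outage too: amplify-and-forward relays at most
the signal-to-noise ratio of its first hop, and in decode-and-forward the relay fails to decode. -/
theorem inOutage_of_norm_sq_lt (p : Protocol) {ρ : ℝ} (hρ : 0 < ρ) (R : ℝ) (g : Gains)
    (hsd : ‖g Link.sd‖ ^ 2 < (Real.exp R - 1) / ρ)
    (hsr : ‖g Link.sr‖ ^ 2 < Real.exp R * (Real.exp R - 1) / ρ) :
    InOutage p ρ R g Mode.relayed := by
  rw [← snr_lt_iff hρ] at hsd hsr
  have h1 := snr_nonneg hρ g Link.sd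
  have h2 := snr_nonneg hρ g Link.sr
  have h3 := snr_nonneg hρ g Link.rd
  cases p with
  | AF =>
    change 1 / 2 * Real.log _ < R
    have hf : snr ρ g Link.sr * snr ρ g Link.rd / (snr ρ g Link.sr + snr ρ g Link.rd + 1)
        ≤ snr ρ g Link.sr := by
      rw [div_le_iff₀ (by linarith)]
      nlinarith
    rw [half_log_lt_iff (by positivity)]
    nlinarith
  | DF =>
    change dfMI ρ R g < R
    have hnd : ¬ RelayDecodes ρ R g := by
      rw [relayDecodes_iff hρ, not_le]
      nlinarith
    rw [dfMI, if_neg hnd, half_log_lt_iff (by positivity)]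
    nlinarith [sq_nonneg (Real.exp R - 1)]

/-- In amplify-and-forward, `f (x, y) ≥ m / 2 - 1 / 4` for `m = min x y`, so that both hops cannot be
strong during an outage. -/
theorem norm_sq_lt_of_inOutage_relayed (p : Protocol) {ρ : ℝ} (hρ : 0 < ρ) {R : ℝ} (hR : 0 < R)
    (g : Gains) (h : InOutage p ρ R g Mode.relayed) :
    ‖g Link.sr‖ ^ 2 < 2 * Real.exp R ^ 2 / ρ ∨ ‖g Link.rd‖ ^ 2 < 2 * Real.exp R ^ 2 / ρ := by
  rw [← snr_lt_iff hρ, ← snr_lt_iff hρ]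
  have h1 := snr_nonneg hρ g Link.sd
  have h2 := snr_nonneg hρ g Link.sr
  have h3 := snr_nonneg hρ g Link.rd
  have he : 1 < Real.exp R := Real.one_lt_exp_iff.2 hR
  by_contra! hc
  cases p with
  | AF =>
    change 1 / 2 * Real.log _ < R at h
    rw [half_log_lt_iff (by positivity)] at h
    have hf : Real.exp R ^ 2 - 1 ≤
        snr ρ g Link.sr * snr ρ g Link.rd / (snr ρ g Link.sr + snr ρ g Link.rd + 1) := by
      rw [le_div_iff₀ (by linarith)]
      nlinarith [mul_nonneg (sub_nonneg.2 hc.1) (sub_nonneg.2 hc.2)]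
    linarith
  | DF =>
    change dfMI ρ R g < R at h
    have hd : RelayDecodes ρ R g := by
      rw [relayDecodes_iff hρ]
      nlinarith
    rw [dfMI, if_pos hd, half_log_lt_iff (by positivity)] at h
    nlinarith

theorem outageEvent_direct_eq {Ω : Type*} (h : Link → Ω → ℂ) (p : Protocol) {ρ : ℝ}
    (hρ : 0 < ρ) (R : ℝ) :
    outageEvent h p ρ R Mode.direct = {ω | ‖h Link.sd ω‖ ^ 2 < (Real.exp R - 1) / ρ} :=
  Set.ext fun _ => inOutage_direct_iff p hρ R _

/-! ### Selection rules -/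

theorem bothOutage_subset {Ω : Type*} (h : Link → Ω → ℂ) (p : Protocol) (R : ℝ → ℝ)
    (s : SelectionRule) (ρ : ℝ) :
    outageEvent h p ρ (R ρ) Mode.direct ∩ outageEvent h p ρ (R ρ) Mode.relayed ⊆
      {ω | InOutage p ρ (R ρ) (fun l => h l ω) (s ρ (fun l => h l ω))} := by
  rintro ω ⟨h1, h2⟩
  change InOutage p ρ (R ρ) (fun l => h l ω) (s ρ (fun l => h l ω))
  cases s ρ (fun l => h l ω)
  exacts [h1, h2]

theorem isOpportunistic_directFirstRule (p : Protocol) (R : ℝ → ℝ) :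
    IsOpportunistic p R (directFirstRule p R) := by
  refine Eventually.of_forall fun ρ g h => ?_
  unfold directFirstRule at h
  split_ifs at h with hd
  · rintro (_ | _)
    exacts [hd, h]
  · exact absurd h hd

theorem isOpportunistic_maxMIRule (p : Protocol) (R : ℝ → ℝ) :
    IsOpportunistic p R (maxMIRule p R) := by
  refine Eventually.of_forall fun ρ g h => ?_
  unfold maxMIRule at h
  split_ifs at h with hd
  · rintro (_ | _)
    exacts [hd.trans h, h]
  · rintro (_ | _)
    exacts [h, (not_lt.1 hd).trans_lt h]

/-! ### Outage probabilities -/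

section Probability

variable {Ω : Type*} [MeasurableSpace Ω] {μ : Measure Ω} {h : Link → Ω → ℂ} {v : ℝ≥0}

theorem measureReal_norm_sq_lt (hlaw : ∀ l, HasLaw (h l) (complexGaussian v) μ) (l : Link)
    (t : ℝ) : μ.real {ω | ‖h l ω‖ ^ 2 < t} = gainProb v t := by
  rw [gainProb, ← (hlaw l).map_eq, measureReal_def, measureReal_def,
    Measure.map_apply_of_aemeasurable (hlaw l).aemeasurable (measurableSet_norm_sq_lt t)]
  rfl

theorem measureReal_norm_sq_lt_and (hlaw : ∀ l, HasLaw (h l) (complexGaussian v) μ)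
    (hindep : iIndepFun h μ) {l l' : Link} (hl : l ≠ l') (t t' : ℝ) :
    μ.real ({ω | ‖h l ω‖ ^ 2 < t} ∩ {ω | ‖h l' ω‖ ^ 2 < t'}) = gainProb v t * gainProb v t' := by
  rw [← measureReal_norm_sq_lt hlaw l, ← measureReal_norm_sq_lt hlaw l', measureReal_def,
    measureReal_def, measureReal_def, ← ENNReal.toReal_mul]
  congr 1
  exact (hindep.indepFun hl).measure_inter_preimage_eq_mul _ _
    (measurableSet_norm_sq_lt t) (measurableSet_norm_sq_lt t')

theorem hasDiversity_directOutage (hv : 0 < v) (hlaw : ∀ l, HasLaw (h l) (complexGaussian v) μ)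
    (p : Protocol) {r : ℝ} {R : ℝ → ℝ} (hR : HasMultiplexingGain R r) :
    HasDiversity (modeOutageProb μ h p R Mode.direct) (max (1 - r) 0) := by
  refine (hR.directThreshold.gainProb hv).congr ?_
  filter_upwards [eventually_gt_atTop 0] with ρ hρ
  rw [modeOutageProb, outageEvent_direct_eq h p hρ, measureReal_norm_sq_lt hlaw]

theorem hasDiversity_bothOutage [IsProbabilityMeasure μ] (hv : 0 < v)
    (hlaw : ∀ l, HasLaw (h l) (complexGaussian v) μ) (hindep : iIndepFun h μ)
    (p : Protocol) {r : ℝ} {R : ℝ → ℝ} (hR : HasMultiplexingGain R r) :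
    HasDiversity (fun ρ => μ.real
        (outageEvent h p ρ (R ρ) Mode.direct ∩ outageEvent h p ρ (R ρ) Mode.relayed))
      (max (1 - r) 0 + max (1 - 2 * r) 0) := by
  have hd := hR.directThreshold.gainProb hv
  refine (hd.mul (hR.lowerThreshold.gainProb hv)).squeeze
    ((hd.mul (hR.upperThreshold.gainProb hv)).const_mul two_pos) ?_ ?_
  · filter_upwards [eventually_gt_atTop 0] with ρ hρ
    rw [← measureReal_norm_sq_lt_and hlaw hindep (show Link.sd ≠ Link.sr by simp),
      outageEvent_direct_eq h p hρ]
    exact measureReal_mono fun ω hω => ⟨hω.1, inOutage_of_norm_sq_lt p hρ _ _ hω.1 hω.2⟩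
  · obtain ⟨c, hc, hcR⟩ := hR.2
    filter_upwards [eventually_gt_atTop 0, hcR] with ρ hρ hRρ
    rw [two_mul]
    nth_rewrite 1 [← measureReal_norm_sq_lt_and hlaw hindep (show Link.sd ≠ Link.sr by simp)]
    rw [← measureReal_norm_sq_lt_and hlaw hindep (show Link.sd ≠ Link.rd by simp),
      outageEvent_direct_eq h p hρ]
    refine (measureReal_mono fun ω hω => ?_).trans (measureReal_union_le _ _)
    exact (norm_sq_lt_of_inOutage_relayed p hρ (hc.trans_le hRρ) _ hω.2).imp
      (fun h' => ⟨hω.1, h'⟩) (fun h' => ⟨hω.1, h'⟩)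

theorem IsOpportunistic.systemOutageProb_eq {p : Protocol} {R : ℝ → ℝ} {s : SelectionRule}
    (hs : IsOpportunistic p R s) (μ : Measure Ω) (h : Link → Ω → ℂ) :
    ∀ᶠ ρ in atTop, μ.real
        (outageEvent h p ρ (R ρ) Mode.direct ∩ outageEvent h p ρ (R ρ) Mode.relayed) =
      systemOutageProb μ h p R s ρ := by
  filter_upwards [hs] with ρ hρ
  rw [systemOutageProb]
  exact congrArg μ.real ((bothOutage_subset h p R s ρ).antisymm
    fun ω hω => ⟨hρ _ hω Mode.direct, hρ _ hω Mode.relayed⟩)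

theorem relayedOutageProbGivenDirect_eq (hlaw : ∀ l, HasLaw (h l) (complexGaussian v) μ)
    (p : Protocol) (R : ℝ → ℝ) {ρ : ℝ} (hρ : 0 < ρ) :
    μ.real (outageEvent h p ρ (R ρ) Mode.direct ∩ outageEvent h p ρ (R ρ) Mode.relayed) *
        (modeOutageProb μ h p R Mode.direct ρ)⁻¹ =
      relayedOutageProbGivenDirect μ h p R ρ := by
  -- The coefficients are only almost everywhere measurable, so the direct outage event is merely
  -- null measurable.
  have hm : NullMeasurableSet (outageEvent h p ρ (R ρ) Mode.direct) μ := by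
    rw [outageEvent_direct_eq h p hρ]
    exact (hlaw Link.sd).aemeasurable.nullMeasurableSet_preimage (measurableSet_norm_sq_lt _)
  rw [relayedOutageProbGivenDirect, modeOutageProb, measureReal_def, measureReal_def,
    measureReal_def, ProbabilityTheory.cond, Measure.smul_apply, Measure.restrict_apply₀' hm,
    smul_eq_mul, ENNReal.toReal_mul, ENNReal.toReal_inv, Set.inter_comm, mul_comm]

end Probability

end RelayChannel

theorem theorem1 {Ω : Type*} [MeasurableSpace Ω] (μ : Measure Ω) [IsProbabilityMeasure μ]
    (h : RelayChannel.Link → Ω → ℂ) (v : ℝ≥0) (hv : 0 < v)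
    (hlaw : ∀ l, HasLaw (h l) (RelayChannel.complexGaussian v) μ)
    (hindep : iIndepFun h μ)
    (p : RelayChannel.Protocol) (r : ℝ) (R : ℝ → ℝ)
    (hR : RelayChannel.HasMultiplexingGain R r) :
    (∀ s : RelayChannel.SelectionRule, RelayChannel.IsOpportunistic p R s →
      RelayChannel.HasDiversity (RelayChannel.systemOutageProb μ h p R s)
        (max (1 - r) 0 + max (1 - 2 * r) 0)) ∧
    RelayChannel.IsOpportunistic p R (RelayChannel.directFirstRule p R) ∧
    RelayChannel.IsOpportunistic p R (RelayChannel.maxMIRule p R) ∧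
    (∀ s : RelayChannel.SelectionRule,
      RelayChannel.DiversityAtMost (RelayChannel.systemOutageProb μ h p R s)
        (max (1 - r) 0 + max (1 - 2 * r) 0)) ∧
    RelayChannel.HasDiversity
      (RelayChannel.modeOutageProb μ h p R RelayChannel.Mode.direct) (max (1 - r) 0) ∧
    RelayChannel.HasDiversity
      (RelayChannel.relayedOutageProbGivenDirect μ h p R) (max (1 - 2 * r) 0) := by
  have hboth := RelayChannel.hasDiversity_bothOutage hv hlaw hindep p hR
  have hdirect := RelayChannel.hasDiversity_directOutage hv hlaw p hR
  refine ⟨fun s hs => hboth.congr (hs.systemOutageProb_eq μ h),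
    RelayChannel.isOpportunistic_directFirstRule p R,
    RelayChannel.isOpportunistic_maxMIRule p R, fun s => ?_, hdirect, ?_⟩
  · exact hboth.diversityAtMost_of_le
      (Eventually.of_forall fun ρ => measureReal_mono (RelayChannel.bothOutage_subset h p R s ρ))
  · have hquot := hboth.mul hdirect.inv
    rw [add_neg_cancel_comm] at hquot
    exact hquot.congr ((eventually_gt_atTop 0).mono fun ρ hρ =>
      RelayChannel.relayedOutageProbGivenDirect_eq hlaw p R hρ)
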